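/- **Definitions.** All logarithms are to base 2. *Synchronizers.* For integers $r\ge 0$, $k\ge 1$, an $(r,k)$-instance is a set $K$ of $k$ positive integers (node IDs) with $\lfloor\sum_{v\in K}\log v\rfloor=r$, together with a wake-up function $\omega:K\to\mathbb N$; put $\omega(K)=\min_{v\in K}\omega(v)$. Let $S$ assign to every ID $v$ an infinite $0/1$ sequence $S(v)_1,S(v)_2,\dots$, and put $S(v)_i=0$ for $i\le 0$. For $g:\mathbb N\times\mathbb N\to\mathbb N$, $S$ is an *unbounded universal synchronizer of delay $g$* if for every $(r,k)$-instance there is a time-step $j\le\omega(K)+g(r,k)$ with $\sum_{v\in K}S(v)_{j-\omega(v)}=1$. Write $\rho(n)=\max(1,\log n)/\max(1,\log\log n)$, with $\max(1,\log\log n)$ read as $1$ for $n=1$; thus $\rho(n)=\frac{\log n}{\log\log n}$ for $n\ge 4$, $\rho(n)\le\frac{\log n}{\log\log n}$ for $n=3$, and $\rho(1)=\rho(2)=1$. We write $g(r,k)=O\!\left(\frac{r\log k}{\log\log k}\right)$ if there is a constant $c$ with $g(r,k)\le c\,r\,\rho(k)$ for all $r,k\ge1$. *Radio networks.* A radio network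 is a finite directed graph on $n$ nodes in which every node is reachable from every other one, whose nodes have distinct IDs in $\{1,\dots,L\}$. Time is divided into steps. All nodes are initially dormant, and dormant nodes only listen. An adversary chooses a non-empty set of nodes and for each of them an arbitrary time-step at which it wakes up spontaneously (if it is not yet awake). A listening node receives a message in a time-step iff exactly one of its in-neighbours transmits in that step, and a dormant node that receives a message wakes up in that time-step. *The wake-up algorithm given by $S$*: a node with ID $v$ that woke up in time-step $\omega(v)$ transmits in time-step $\omega(v)+j$ ($j=1,2,\dots$) iff $S(v)_j=1$. (So a node uses only its own ID and the number of steps since it woke up; it knows neither $n$ nor $L$, nor anything about the network.) **Theorem.** There exists an unbounded universal synchronizer of some delay $g$ with $g(r,k)=O\!\left(\frac{r\log k}{\log\log k}\right)$. Moreover, for every such synchronizer $S$ there is a constant $C$ such that in every radio network with $n$ nodes and IDs from $\{1,\dots,L\}$, and for every choice of the adversary, the wake-up algorithm given by $S$ wakes up all nodes, each within $C\,n\,\log L\,\rho(n)$ time-steps of the first wake-up; that is, it performs wake-up in time $O\!\left(\frac{n\log L\log n}{\log\log n}\right)$, without knowledge of $n$ or $L$. -/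

import Mathlib

/-- The expression `log n / log log n` (base-2 logarithms), with both the numerator and the
denominator replaced by `1` when they are smaller than `1` (the quotient itself is undefined or
degenerate for `n = 1, 2`).  It equals `log n / log log n` for every `n ≥ 4`, and it is at most
`log n / log log n` for `n = 3`. -/
noncomputable def logRatio (n : ℕ) : ℝ :=
  max 1 (Real.logb 2 n) / max 1 (Real.logb 2 (Real.logb 2 n))

/-- `K`, a set of node IDs (positive integers), is the node set of an `(r, k)`-instance: it has
`k ≥ 1` elements and the sum of the binary logarithms of the IDs, rounded down, is `r`. -/
def IsInstance (r k : ℕ) (K : Finset ℕ) : Prop :=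
  K.Nonempty ∧ (∀ v ∈ K, 1 ≤ v) ∧ K.card = k ∧ ⌊∑ v ∈ K, Real.logb 2 (v : ℝ)⌋₊ = r

/-- The nodes of `K` that transmit in time-step `j` if every `v ∈ K` wakes up in time-step `ω v`
and transmits in time-step `ω v + i` (`i = 1, 2, …`) iff `S v i = true`. The sequences are
indexed by positive integers; the entry `S v 0` is never used. -/
def transmitters (S : ℕ → ℕ → Bool) (K : Finset ℕ) (ω : ℕ → ℕ) (j : ℕ) : Finset ℕ :=
  K.filter fun v => ω v < j ∧ S v (j - ω v) = true

/-- `S` is an unbounded universal synchronizer of delay `g`: for every `(r, k)`-instance with node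
set `K` and wake-up function `ω`, some time-step `j ≤ min_{v ∈ K} ω v + g r k` has exactly one
transmitter. -/
def IsUnboundedUniversalSynchronizer (S : ℕ → ℕ → Bool) (g : ℕ → ℕ → ℕ) : Prop :=
  ∀ (r k : ℕ) (K : Finset ℕ), IsInstance r k K → ∀ (hK : K.Nonempty) (ω : ℕ → ℕ),
    ∃ j : ℕ, j ≤ K.inf' hK ω + g r k ∧ (transmitters S K ω j).card = 1

/-- `g(r, k) = O(r log k / log log k)`.  (For `r = 0`, which happens only for the single node with
ID `1`, the value of `g` is merely a constant.) -/
def HasSynchronizerDelay (g : ℕ → ℕ → ℕ) : Prop :=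
  ∃ C : ℝ, ∀ r k : ℕ, 1 ≤ r → 1 ≤ k → (g r k : ℝ) ≤ C * (r * logRatio k)

/-- Every node is reachable from every other node along directed edges. -/
def IsStronglyConnected {V : Type*} (G : Digraph V) : Prop :=
  ∀ u v : V, Relation.ReflTransGen G.Adj u v

/-- Given the wake-up times `w` of the nodes that are awake (`none` for dormant nodes), node `u`
transmits in time-step `t` under the wake-up algorithm: `u` woke up in some earlier time-step `s`
and `S (ident u) (t - s) = true`.  The decision depends only on the node's own ID and on its local
clock `t - s`. -/
def Transmits {V : Type*} (S : ℕ → ℕ → Bool) (ident : V → ℕ) (w : V → Option ℕ)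
    (u : V) (t : ℕ) : Prop :=
  ∃ s : ℕ, w u = some s ∧ s < t ∧ S (ident u) (t - s) = true

/-- A listening node `v` receives a message in time-step `t`: exactly one in-neighbour of `v`
transmits. -/
def Receives {V : Type*} (G : Digraph V) (S : ℕ → ℕ → Bool) (ident : V → ℕ) (w : V → Option ℕ)
    (v : V) (t : ℕ) : Prop :=
  ∃! u : V, G.Adj u v ∧ Transmits S ident w u t

open Classical in
/-- The execution of the wake-up algorithm in the radio network `G` with IDs `ident`.  The
adversary's choice is `σ`: if `σ v = some t`, then `v` wakes up spontaneously in time-step `t`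
(unless it is already awake); if `σ v = none`, then `v` does not wake up spontaneously.
`wakeState G S ident σ t v` is `some s` if `v` woke up in time-step `s < t`, and `none` if `v`
is dormant at the beginning of time-step `t`.  A dormant node (which is always listening) wakes up
in time-step `t` iff it does so spontaneously or receives a message in time-step `t`. -/
noncomputable def wakeState {V : Type*} (G : Digraph V) (S : ℕ → ℕ → Bool) (ident : V → ℕ)
    (σ : V → Option ℕ) : ℕ → V → Option ℕ
  | 0 => fun _ => none
  | t + 1 => fun v =>
      match wakeState G S ident σ t v with
      | some s => some s
      | none =>
          if σ v = some t ∨ Receives G S ident (wakeState G S ident σ t) v t then some t else none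

/-- In the execution of the wake-up algorithm, node `v` wakes up in time-step `t`. -/
def WakesAt {V : Type*} (G : Digraph V) (S : ℕ → ℕ → Bool) (ident : V → ℕ)
    (σ : V → Option ℕ) (v : V) (t : ℕ) : Prop :=
  wakeState G S ident σ (t + 1) v = some t

/-!
Existence of a synchronizer is shown by the probabilistic method. Let the node with ID `v` transmit
at age `i` with probability `c ℓ / (i + 2 c ℓ)`, where `ℓ = ln (v + 1)` and `c` is a constant, all
choices being independent. Fix an instance `(K, ω)` of weight `R = ∑ ℓ` and size `k`, and let `M` be
the least integer with `k ≤ M ^ M`, so that `M` is of order `log k / log log k`; the delay `T` is of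
order `R M`. Call the expected number `f` of transmitters in a time-step its load; exactly one node
transmits with probability at least `f exp (-2 f)` (`randomBits_notExactlyOne_le`).

* In a smallest instance on which the synchronizer fails, the nodes awake at time `t` must not have
  exhausted their own delay (`IsCritical`). Hence their weight is at least of order `t / M`, and the
  load never drops below a constant times `1 / M` (`IsCritical.le_load`).
* By Jensen's inequality the total load is at most of order `R log k`, and `log k ≤ M log M`, so
  the average load is at most a small multiple of `log M` plus a constant
  (`IsCritical.sum_load_le`). In half of the time-steps the load is thus so small that
  `f exp (-2 f)` is of order at least `1 / M` (`sum_mul_exp_ge`).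

Multiplying over the `T` time-steps, the instance fails with probability at most `exp (-30 R)`. As
distinct IDs force `k log k ≤ 2 R` (`card_mul_log_card_le`), there are only `exp (22 R)` wake-up
functions to consider for each `K`, and `∑ exp (-8 R)` over all sets `K` is dominated by
`∏ (1 + (v + 1) ^ (-3)) - 1 < 1`. Hence some choice of the sequences never fails.

For the network, take a walk from the first awake node to `v`, and let the layer of a walk node `x`
consist of the in-neighbours of `x` that belong neither to `{v}` nor to the layer of a later walk
node (`exists_layers`). While the nodes ahead of a layer are dormant, `x` hears only its layer, so
the synchronizer property makes the signal leave the layer within `g (r, k)` steps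
(`exists_wakesAt_of_inNeighbours`). Layers are disjoint, so the values `r` add up to at most
`n log L`, and the factors `log k / log log k` are at most twice that of `n`
(`logRatio_le_two_mul`).
-/

/-! ### Independent random bits -/

section RandomBits

open MeasureTheory ProbabilityTheory

variable {ι : Type*}

/-- The law of a family of independent random bits, the bit `e` being `true` with probability
`p e`. -/
noncomputable def randomBits (p : ι → unitInterval) : Measure (ι → Bool) :=
  Measure.infinitePi fun e => bernoulliMeasure true false (p e)

instance (p : ι → unitInterval) : IsProbabilityMeasure (randomBits p) := by
  unfold randomBits; infer_instance

/-- The event that the number of `true` bits in the block `E` is not one. -/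
def notExactlyOne (E : Finset ι) : Set (ι → Bool) :=
  {S | (E.filter fun e => S e = true).card ≠ 1}

/-- The event depends only on the bits of any finite set containing the block. -/
lemma exists_notExactlyOne_eq_preimage {U E : Finset ι} (hEU : E ⊆ U) : ∃ A : Set (U → Bool),
    notExactlyOne E = (fun (S : ι → Bool) (e : U) => S e) ⁻¹' A := by
  classical
  refine ⟨{s | (U.attach.filter fun e : U => s e = true ∧ (e : ι) ∈ E).card ≠ 1}, ?_⟩
  ext S
  have : (U.attach.filter fun e : U => S e = true ∧ (e : ι) ∈ E).card
      = (E.filter fun e => S e = true).card := by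
    rw [Finset.filter_attach (fun e => S e = true ∧ e ∈ E) U]
    simp only [Finset.card_map, Finset.card_attach]
    congr 1
    ext x
    simp only [Finset.mem_filter]
    exact ⟨fun h => ⟨h.2.2, h.2.1⟩, fun h => ⟨hEU h.1, h.2, h.1⟩⟩
  simp only [notExactlyOne, Set.mem_ofPred_eq, Set.mem_preimage, this]

/-- `1 - q ≥ exp (-2q)` on `[0, 1/2]`. -/
lemma exp_neg_two_mul_le_one_sub {q : ℝ} (h0 : 0 ≤ q) (h : q ≤ 1 / 2) :
    Real.exp (-(2 * q)) ≤ 1 - q := by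
  have h1 : 1 + 2 * q ≤ Real.exp (2 * q) := by linarith [Real.add_one_le_exp (2 * q)]
  rw [Real.exp_neg, inv_le_comm₀ (Real.exp_pos _) (by linarith)]
  refine le_trans ?_ h1
  rw [inv_le_iff_one_le_mul₀ (by linarith)]
  nlinarith

lemma randomBits_real_exactly (p : ι → unitInterval) [DecidableEq ι] (E : Finset ι) {e : ι}
    (he : e ∈ E) :
    (randomBits p).real (Set.pi (E : Set ι) fun x => {decide (x = e)})
      = p e * ∏ x ∈ E.erase e, (1 - (p x : ℝ)) := by
  rw [measureReal_def, randomBits, Measure.infinitePi_pi _ (fun _ _ => MeasurableSet.of_discrete),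
    ENNReal.toReal_prod, ← Finset.mul_prod_erase _ _ he]
  congr 1
  · simp
  · refine Finset.prod_congr rfl fun x hx => ?_
    simp [(Finset.mem_erase.1 hx).1]

/-- With expected number of ones `f`, a block of bits contains exactly one `true` with probability
at least `f * exp (-2 f)`. -/
lemma randomBits_notExactlyOne_le (p : ι → unitInterval) (E : Finset ι)
    (hp : ∀ e ∈ E, (p e : ℝ) ≤ 1 / 2) :
    (randomBits p).real (notExactlyOne E) ≤
      Real.exp (-((∑ e ∈ E, (p e : ℝ)) * Real.exp (-(2 * ∑ e ∈ E, (p e : ℝ))))) := by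
  classical
  set f := ∑ e ∈ E, (p e : ℝ)
  set A : ι → Set (ι → Bool) := fun e => Set.pi (E : Set ι) fun x => {decide (x = e)}
  have hA : ∀ e, MeasurableSet (A e) := fun e =>
    MeasurableSet.pi E.countable_toSet fun _ _ => MeasurableSet.of_discrete
  have hdisj : Set.PairwiseDisjoint (E : Set ι) A := by
    intro a ha b hb hab
    refine Set.disjoint_left.2 fun S h1 h2 => hab ?_
    have h1 := h1 a ha
    have h2 := h2 a ha
    simp at h1 h2
    simpa [h1] using h2
  have hsub : notExactlyOne E ⊆ (⋃ e ∈ E, A e)ᶜ := by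
    intro S hS hS'
    simp only [Set.mem_iUnion] at hS'
    obtain ⟨e, he, hSe⟩ := hS'
    apply hS
    rw [Finset.card_eq_one]
    refine ⟨e, ?_⟩
    ext x
    simp only [Finset.mem_filter, Finset.mem_singleton]
    constructor
    · rintro ⟨hx, hx'⟩
      have := hSe x hx
      simpa [hx'] using this
    · rintro rfl
      exact ⟨he, by simpa using hSe x he⟩
  have hlow : f * Real.exp (-(2 * f)) ≤ (randomBits p).real (⋃ e ∈ E, A e) := by
    rw [measureReal_biUnion_finset hdisj (fun e _ => hA e), Finset.sum_mul]
    refine Finset.sum_le_sum fun e he => ?_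
    rw [randomBits_real_exactly p E he]
    refine mul_le_mul_of_nonneg_left ?_ (p e).2.1
    calc Real.exp (-(2 * f)) ≤ Real.exp (∑ x ∈ E.erase e, -(2 * (p x : ℝ))) := by
          rw [Real.exp_le_exp, Finset.sum_neg_distrib, neg_le_neg_iff, ← Finset.mul_sum]
          gcongr
          exact Finset.sum_le_sum_of_subset_of_nonneg (Finset.erase_subset _ _)
            fun x _ _ => (p x).2.1
      _ = ∏ x ∈ E.erase e, Real.exp (-(2 * (p x : ℝ))) := Real.exp_sum _ _
      _ ≤ _ := Finset.prod_le_prod (fun _ _ => (Real.exp_pos _).le) fun x hx =>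
          exp_neg_two_mul_le_one_sub (p x).2.1 (hp x (Finset.mem_of_mem_erase hx))
  calc (randomBits p).real (notExactlyOne E)
      ≤ (randomBits p).real (⋃ e ∈ E, A e)ᶜ := measureReal_mono hsub
    _ = 1 - (randomBits p).real (⋃ e ∈ E, A e) :=
        probReal_compl_eq_one_sub (E.measurableSet_biUnion fun e _ => hA e)
    _ ≤ 1 - f * Real.exp (-(2 * f)) := by linarith
    _ ≤ _ := Real.one_sub_le_exp_neg _

/-- Events depending on disjoint blocks of bits are independent. -/
lemma randomBits_biInter_notExactlyOne (p : ι → unitInterval) {J : Type*} (s : Finset J)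
    (E : J → Finset ι) (hE : (s : Set J).PairwiseDisjoint E) :
    (randomBits p).real (⋂ j ∈ s, notExactlyOne (E j)) =
      ∏ j ∈ s, (randomBits p).real (notExactlyOne (E j)) := by
  classical
  induction s using Finset.induction_on with
  | empty => simp
  | insert a s ha ih =>
    rw [Finset.prod_insert ha, ← ih (hE.subset (by simp)), Finset.set_biInter_insert]
    have hd : Disjoint (E a) (s.biUnion E) := by
      rw [Finset.disjoint_biUnion_right]
      intro b hb
      exact hE (by simp) (by simp [hb]) (by rintro rfl; exact ha hb)
    have hind : iIndepFun (fun (e : ι) (S : ι → Bool) => S e) (randomBits p) :=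
      iIndepFun_infinitePi (X := fun _ x => x) (fun _ => measurable_id)
    have h2 := hind.indepFun_finset _ _ hd (fun e => measurable_pi_apply e)
    obtain ⟨A, hA⟩ := exists_notExactlyOne_eq_preimage (subset_refl (E a))
    have : ∃ B : Set (s.biUnion E → Bool), (⋂ j ∈ s, notExactlyOne (E j)) =
        (fun (S : ι → Bool) (e : s.biUnion E) => S e) ⁻¹' B := by
      choose! B hB using fun j (hj : j ∈ s) =>
        exists_notExactlyOne_eq_preimage (Finset.subset_biUnion_of_mem E hj)
      refine ⟨⋂ j ∈ s, B j, ?_⟩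
      rw [Set.preimage_iInter₂]
      exact Set.iInter₂_congr hB
    obtain ⟨B, hB⟩ := this
    rw [hA, hB]
    have := h2.measure_inter_preimage_eq_mul A B (Set.toFinite _).measurableSet
      (Set.toFinite _).measurableSet
    simp only [measureReal_def, this, ENNReal.toReal_mul]

lemma randomBits_biInter_notExactlyOne_le (p : ι → unitInterval) {J : Type*} (s : Finset J)
    (E : J → Finset ι) (hE : (s : Set J).PairwiseDisjoint E)
    (hp : ∀ e, (p e : ℝ) ≤ 1 / 2) :
    (randomBits p).real (⋂ j ∈ s, notExactlyOne (E j)) ≤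
      Real.exp (-∑ j ∈ s,
        (∑ e ∈ E j, (p e : ℝ)) * Real.exp (-(2 * ∑ e ∈ E j, (p e : ℝ)))) := by
  rw [randomBits_biInter_notExactlyOne p s E hE, ← Finset.sum_neg_distrib, Real.exp_sum]
  exact Finset.prod_le_prod (fun _ _ => measureReal_nonneg)
    fun j _ => randomBits_notExactlyOne_le p (E j) fun e _ => hp e

end RandomBits

/-! ### The function `log n / log log n` -/

lemma logb_two_le_self {s : ℝ} (hs : 0 < s) : Real.logb 2 s ≤ s := by
  have h2 : (0.69 : ℝ) < Real.log 2 := by linarith [Real.log_two_gt_d9]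
  have h3 : Real.log 2 < 0.7 := by linarith [Real.log_two_lt_d9]
  rw [Real.logb, div_le_iff₀ (by linarith)]
  have h4 : Real.log (s / 2) ≤ s / 2 - 1 := Real.log_le_sub_one_of_pos (by linarith)
  rw [Real.log_div hs.ne' two_ne_zero] at h4
  nlinarith

/-- The real function `x / max 1 (log₂ x)` underlying `logRatio`. -/
noncomputable def divLog (x : ℝ) : ℝ := x / max 1 (Real.logb 2 x)

lemma logRatio_eq_divLog (n : ℕ) : logRatio n = divLog (max 1 (Real.logb 2 n)) := by
  unfold logRatio divLog
  congr 1
  rcases le_total 1 (Real.logb 2 n) with h | h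
  · rw [max_eq_right h]
  · rw [max_eq_left h, Real.logb_one, max_eq_left zero_le_one, max_eq_left]
    have h0 : 0 ≤ Real.logb 2 n := by
      rcases Nat.eq_zero_or_pos n with rfl | hn
      · simp
      · exact Real.logb_nonneg one_lt_two (by exact_mod_cast hn)
    exact le_trans (Real.logb_nonpos one_lt_two h0 h) zero_le_one

lemma one_le_divLog {x : ℝ} (hx : 1 ≤ x) : 1 ≤ divLog x := by
  unfold divLog
  rw [one_le_div (by positivity)]
  exact max_le hx (logb_two_le_self (by linarith))

lemma one_le_logRatio (n : ℕ) : 1 ≤ logRatio n := by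
  rw [logRatio_eq_divLog]; exact one_le_divLog (le_max_left _ _)

/-- `x / max 1 (log₂ x)` is not monotone near `x = 2`, but it is so up to a factor `2`. -/
lemma divLog_le_two_mul {a b : ℝ} (ha : 1 ≤ a) (hab : a ≤ b) : divLog a ≤ 2 * divLog b := by
  unfold divLog
  have ha0 : 0 < a := by linarith
  have hb0 : 0 < b := by linarith
  set A := max 1 (Real.logb 2 a)
  have hA : 1 ≤ A := le_max_left _ _
  have hA' : Real.logb 2 a ≤ A := le_max_right _ _
  have hba : 1 ≤ b / a := by rwa [one_le_div ha0]
  have h1 : Real.logb 2 b = Real.logb 2 a + Real.logb 2 (b / a) := by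
    rw [Real.logb_div hb0.ne' ha0.ne']; ring
  have h2 := logb_two_le_self (s := b / a) (by positivity)
  have hB : max 1 (Real.logb 2 b) ≤ A * (2 * (b / a)) := by
    refine max_le ?_ ?_
    · nlinarith
    · rw [h1]; nlinarith
  rw [← mul_div_assoc, div_le_div_iff₀ (by positivity) (by positivity)]
  calc a * max 1 (Real.logb 2 b) ≤ a * (A * (2 * (b / a))) := by gcongr
    _ = 2 * b * A := by field_simp

lemma logRatio_le_two_mul {k n : ℕ} (hk : 1 ≤ k) (hkn : k ≤ n) :
    logRatio k ≤ 2 * logRatio n := by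
  rw [logRatio_eq_divLog, logRatio_eq_divLog]
  refine divLog_le_two_mul (le_max_left _ _) (max_le_max le_rfl ?_)
  exact Real.logb_le_logb_of_le one_lt_two (by exact_mod_cast hk) (by exact_mod_cast hkn)

/-! ### The inverse of `m ↦ m ^ m` -/

lemma exists_le_self_pow_self (k : ℕ) : ∃ m : ℕ, 1 ≤ m ∧ k ≤ m ^ m :=
  ⟨k + 1, by omega, by
    calc k ≤ k + 1 := by omega
      _ = (k + 1) ^ 1 := by ring
      _ ≤ (k + 1) ^ (k + 1) := Nat.pow_le_pow_right (by omega) (by omega)⟩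

/-- The least `m ≥ 1` with `k ≤ m ^ m`: a monotone integer version of `log k / log log k`. -/
def selfPowRoot (k : ℕ) : ℕ := Nat.find (exists_le_self_pow_self k)

lemma one_le_selfPowRoot (k : ℕ) : 1 ≤ selfPowRoot k :=
  (Nat.find_spec (exists_le_self_pow_self k)).1

lemma le_selfPowRoot_pow (k : ℕ) : k ≤ selfPowRoot k ^ selfPowRoot k :=
  (Nat.find_spec (exists_le_self_pow_self k)).2

lemma selfPowRoot_le {k m : ℕ} (hm : 1 ≤ m) (h : k ≤ m ^ m) : selfPowRoot k ≤ m :=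
  Nat.find_min' _ ⟨hm, h⟩

lemma selfPowRoot_mono : Monotone selfPowRoot := fun _ b h =>
  selfPowRoot_le (one_le_selfPowRoot b) (h.trans (le_selfPowRoot_pow b))

lemma selfPowRoot_le_self {k : ℕ} (hk : 1 ≤ k) : selfPowRoot k ≤ k :=
  selfPowRoot_le hk (Nat.le_self_pow (by omega) k)

lemma log_le_selfPowRoot_mul_log {k : ℕ} (hk : 1 ≤ k) :
    Real.log k ≤ selfPowRoot k * Real.log (selfPowRoot k) := by
  rw [← Real.log_pow]
  exact Real.log_le_log (by exact_mod_cast hk) (by exact_mod_cast le_selfPowRoot_pow k)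

lemma selfPowRoot_le_logRatio (k : ℕ) : (selfPowRoot k : ℝ) ≤ 3 * logRatio k := by
  obtain ⟨y, hy⟩ : ∃ y, selfPowRoot k = y + 1 := ⟨selfPowRoot k - 1, by
    have := one_le_selfPowRoot k; omega⟩
  have h1 := one_le_logRatio k
  rw [hy]
  push_cast
  suffices h : (y : ℝ) ≤ 2 * logRatio k by linarith
  rcases Nat.lt_or_ge y 2 with hy2 | hy2
  · have : (y : ℝ) ≤ 1 := by exact_mod_cast Nat.lt_succ_iff.1 hy2
    linarith
  have hlt : y ^ y < k := by
    by_contra! h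
    have := selfPowRoot_le (by omega) h
    omega
  have hy2' : (2 : ℝ) ≤ y := by exact_mod_cast hy2
  have hlog : (1 : ℝ) ≤ Real.logb 2 y := by
    rw [Real.le_logb_iff_rpow_le one_lt_two (by linarith)]; simpa using hy2'
  have hx : y * Real.logb 2 y ≤ Real.logb 2 k := by
    rw [← Real.logb_pow]
    exact Real.logb_le_logb_of_le one_lt_two (by positivity) (by exact_mod_cast hlt.le)
  rw [logRatio_eq_divLog]
  set x := Real.logb 2 k
  have hyx : (y : ℝ) ≤ x := by nlinarith
  rw [max_eq_right (by linarith), divLog, ← mul_div_assoc, le_div_iff₀ (by positivity)]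
  have hx0 : 0 < x := by linarith
  have key : (y : ℝ) * Real.logb 2 x ≤ 2 * x := by
    set s := Real.sqrt x
    have hs : 0 < s := Real.sqrt_pos.2 hx0
    have hss : s ^ 2 = x := Real.sq_sqrt hx0.le
    have hlx : Real.logb 2 x = 2 * Real.logb 2 s := by
      rw [← hss, Real.logb_pow]; norm_num
    rcases le_total (y : ℝ) s with h | h
    · have := logb_two_le_self hs
      rw [hlx]
      nlinarith
    · have := Real.logb_le_logb_of_le one_lt_two hs h
      rw [hlx]
      nlinarith
  rcases max_cases 1 (Real.logb 2 x) with h | h <;> rw [h.1] <;> linarith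

/-! ### The weight of a set of IDs -/

/-- The weight `∑ ln (v + 1)` of a set of IDs; unlike `∑ log v`, every ID contributes at least
`ln 2` to it. -/
noncomputable def weight (K : Finset ℕ) : ℝ := ∑ v ∈ K, Real.log (v + 1)

lemma log_two_le_log_add_one {v : ℕ} (hv : 1 ≤ v) : Real.log 2 ≤ Real.log (v + 1) :=
  Real.log_le_log two_pos (by have : (1 : ℝ) ≤ v := by exact_mod_cast hv
                              linarith)

lemma log_add_one_pos {v : ℕ} (hv : 1 ≤ v) : 0 < Real.log (v + 1) :=
  lt_of_lt_of_le (Real.log_pos one_lt_two) (log_two_le_log_add_one hv)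

lemma card_mul_log_two_le_weight {K : Finset ℕ} (hK : ∀ v ∈ K, 1 ≤ v) :
    K.card * Real.log 2 ≤ weight K := by
  rw [weight, ← nsmul_eq_mul]
  exact Finset.card_nsmul_le_sum _ _ _ fun v hv => log_two_le_log_add_one (hK v hv)

lemma weight_le {K : Finset ℕ} (hK : ∀ v ∈ K, 1 ≤ v) :
    weight K ≤ 2 * ⌊∑ v ∈ K, Real.logb 2 (v : ℝ)⌋₊ + 3 := by
  have h1 : ∀ v ∈ K, Real.log (v + 1) ≤ 2 * Real.logb 2 v + if v = 1 then 1 else 0 := by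
    intro v hv
    have hv1 := hK v hv
    split_ifs with h
    · subst h
      have := Real.log_two_lt_d9
      norm_num
      linarith
    · have hv2 : (2 : ℝ) ≤ v := by exact_mod_cast (by omega : 2 ≤ v)
      have h3 : Real.log (v + 1) ≤ Real.log ((v : ℝ) ^ 2) :=
        Real.log_le_log (by linarith) (by nlinarith)
      rw [Real.log_pow] at h3
      have h4 : Real.log v ≤ Real.logb 2 v := by
        rw [Real.logb, le_div_iff₀ (Real.log_pos one_lt_two)]
        have := Real.log_two_lt_d9
        have := Real.log_nonneg (by linarith : (1 : ℝ) ≤ v)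
        nlinarith
      push_cast at h3
      linarith
  have h2 := Finset.sum_le_sum h1
  rw [Finset.sum_add_distrib, ← Finset.mul_sum] at h2
  have h3 : ∑ v ∈ K, (if v = 1 then (1 : ℝ) else 0) ≤ 1 := by
    rw [Finset.sum_ite_eq']; split_ifs <;> norm_num
  have h4 := (Nat.lt_floor_add_one (∑ v ∈ K, Real.logb 2 (v : ℝ))).le
  rw [weight]
  linarith

lemma le_eight_mul_weight {K : Finset ℕ} (hne : K.Nonempty) (hK : ∀ v ∈ K, 1 ≤ v) :
    2 * ⌊∑ v ∈ K, Real.logb 2 (v : ℝ)⌋₊ + 3 ≤ 8 * weight K := by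
  have h2 := Real.log_two_gt_d9
  have h0 : 0 ≤ ∑ v ∈ K, Real.logb 2 (v : ℝ) := Finset.sum_nonneg fun v hv =>
    Real.logb_nonneg one_lt_two (by exact_mod_cast hK v hv)
  have h1 := Nat.floor_le h0
  have h3 : ∑ v ∈ K, Real.logb 2 (v : ℝ) ≤ weight K / Real.log 2 := by
    rw [weight, Finset.sum_div]
    refine Finset.sum_le_sum fun v hv => ?_
    rw [Real.logb]
    gcongr
    · exact_mod_cast hK v hv
    · linarith
  have h4 := card_mul_log_two_le_weight hK
  have h5 : (1 : ℝ) ≤ K.card := by exact_mod_cast hne.card_pos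
  have hW : 0.69 ≤ weight K := by nlinarith
  have h6 : weight K / Real.log 2 ≤ 1.5 * weight K := by
    rw [div_le_iff₀ (by linarith)]
    nlinarith
  nlinarith

lemma sum_inv_add_one_sq_le (N : ℕ) :
    ∑ v ∈ Finset.Icc 1 N, (1 : ℝ) / (v + 1) ^ 2 ≤ 1 - (1 : ℝ) / (N + 1) := by
  induction N with
  | zero => simp
  | succ N ih =>
    rw [Finset.sum_Icc_succ_top (by omega)]
    have : (1 : ℝ) / ((N + 1 : ℕ) + 1) ^ 2 ≤ 1 / (N + 1) - 1 / ((N + 1 : ℕ) + 1) := by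
      push_cast
      rw [div_sub_div _ _ (by positivity) (by positivity),
        div_le_div_iff₀ (by positivity) (by positivity)]
      ring_nf
      nlinarith [N.cast_nonneg (α := ℝ), sq_nonneg (N : ℝ)]
    push_cast at this ⊢
    linarith

lemma sum_inv_add_one_sq_le_one {K : Finset ℕ} (hK : ∀ v ∈ K, 1 ≤ v) :
    ∑ v ∈ K, (1 : ℝ) / (v + 1) ^ 2 ≤ 1 := by
  have h1 : ∑ v ∈ K, (1 : ℝ) / (v + 1) ^ 2 ≤ ∑ v ∈ Finset.Icc 1 (K.sup id), (1 : ℝ) / (v + 1) ^ 2 :=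
    Finset.sum_le_sum_of_subset_of_nonneg
      (fun v hv => Finset.mem_Icc.2 ⟨hK v hv, Finset.le_sup (f := id) hv⟩)
      fun _ _ _ => by positivity
  have h2 := sum_inv_add_one_sq_le (K.sup id)
  have : (0 : ℝ) ≤ 1 / ((K.sup id : ℕ) + 1) := by positivity
  linarith

/-- Distinct IDs cannot all be small: by Gibbs' inequality against the subprobability weights
`1 / (v + 1) ^ 2`, the weight of `k` IDs is at least `(k ln k) / 2`. -/
lemma card_mul_log_card_le {K : Finset ℕ} (hK : ∀ v ∈ K, 1 ≤ v) :
    K.card * Real.log K.card ≤ 2 * weight K := by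
  rcases K.eq_empty_or_nonempty with rfl | hne
  · simp [weight]
  have hk : (0 : ℝ) < K.card := by exact_mod_cast hne.card_pos
  have h1 : ∀ v ∈ K, Real.log K.card - 2 * Real.log (v + 1) ≤
      K.card * ((1 : ℝ) / (v + 1) ^ 2) - 1 := by
    intro v _
    have h := Real.log_le_sub_one_of_pos (x := K.card * ((1 : ℝ) / (v + 1) ^ 2)) (by positivity)
    rw [mul_one_div, Real.log_div hk.ne' (by positivity), Real.log_pow] at h
    rw [mul_one_div]
    exact_mod_cast h
  have h2 := Finset.sum_le_sum h1
  rw [Finset.sum_sub_distrib, Finset.sum_sub_distrib, ← Finset.mul_sum, ← Finset.mul_sum] at h2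
  simp only [Finset.sum_const, nsmul_eq_mul, mul_one] at h2
  have h3 := sum_inv_add_one_sq_le_one hK
  unfold weight
  nlinarith

/-! ### Sums over time of transmission probabilities -/

lemma sum_div_add_le_log {a : ℝ} (ha : 0 < a) (T : ℕ) :
    ∑ i ∈ Finset.Icc 1 T, 1 / (i + a) ≤ Real.log (1 + T / a) := by
  induction T with
  | zero => simp
  | succ T ih =>
    rw [Finset.sum_Icc_succ_top (by omega)]
    have hT : (0 : ℝ) ≤ T := T.cast_nonneg
    have h := Real.log_le_sub_one_of_pos (x := (1 + T / a) / (1 + (T + 1 : ℕ) / a)) (by positivity)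
    rw [Real.log_div (by positivity) (by positivity)] at h
    have h2 : (1 + T / a) / (1 + (T + 1 : ℕ) / a) - 1 = -(1 / ((T + 1 : ℕ) + a)) := by
      push_cast
      field_simp
      ring
    linarith

/-- Jensen's inequality for the logarithm, with weights `ln (v + 1)`. -/
lemma sum_log_one_add_le {K : Finset ℕ} (hne : K.Nonempty) (hK : ∀ v ∈ K, 1 ≤ v) {b : ℝ}
    (hb : 0 ≤ b) :
    ∑ v ∈ K, Real.log (v + 1) * Real.log (1 + b / Real.log (v + 1)) ≤
      weight K * Real.log (1 + K.card * b / weight K) := by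
  have hW : 0 < weight K := Finset.sum_pos (fun v hv => log_add_one_pos (hK v hv)) hne
  set A := 1 + K.card * b / weight K with hA
  have hA0 : 0 < A := by positivity
  have h1 : ∀ v ∈ K, Real.log (v + 1) * Real.log (1 + b / Real.log (v + 1)) ≤
      Real.log (v + 1) * (Real.log A - 1) + (Real.log (v + 1) + b) / A := by
    intro v hv
    have hl := log_add_one_pos (hK v hv)
    have h := Real.log_le_sub_one_of_pos (x := (1 + b / Real.log (v + 1)) / A) (by positivity)
    rw [Real.log_div (by positivity) hA0.ne'] at h
    have h2 : (Real.log (v + 1) + b) / A = Real.log (v + 1) * ((1 + b / Real.log (v + 1)) / A) := by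
      field_simp
    rw [h2, ← mul_add]
    gcongr
    linarith
  have h2 := Finset.sum_le_sum h1
  rw [Finset.sum_add_distrib, ← Finset.sum_mul, ← Finset.sum_div, Finset.sum_add_distrib] at h2
  simp only [Finset.sum_const, nsmul_eq_mul] at h2
  have h3 : (weight K + K.card * b) / A = weight K := by
    rw [div_eq_iff hA0.ne', hA]; field_simp
  unfold weight at h3 ⊢
  unfold weight at hA
  rw [h3] at h2
  linarith

/-- If the load `f` is at least `1 / (66 M)` at every step and its average is at most
`(2 ln M + ln 33) / 8`, then in half of the steps the load is so small that `f * exp (-2 f)` is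
of order `1 / M`. -/
lemma sum_mul_exp_ge {T : ℕ} {M : ℝ} (hM : 1 ≤ M) {f : ℕ → ℝ}
    (hlow : ∀ t ∈ Finset.Icc 1 T, 1 / (66 * M) ≤ f t)
    (hsum : ∑ t ∈ Finset.Icc 1 T, f t ≤ T / 8 * (2 * Real.log M + Real.log 33)) :
    T / (360 * M) ≤ ∑ t ∈ Finset.Icc 1 T, f t * Real.exp (-(2 * f t)) := by
  have hM0 : 0 < M := by linarith
  set F := (2 * Real.log M + Real.log 33) / 4 with hF
  have hlogM : 0 ≤ Real.log M := Real.log_nonneg hM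
  have hlog33 : 0 < Real.log 33 := Real.log_pos (by norm_num)
  have hF0 : 0 < F := by positivity
  have hf0 : ∀ t ∈ Finset.Icc 1 T, 0 ≤ f t := fun t ht => le_trans (by positivity) (hlow t ht)
  have hexp : 1 / (6 * M) ≤ Real.exp (-(2 * F)) := by
    have : Real.exp (2 * F) ≤ 6 * M := by
      have h36 : Real.log 33 ≤ 2 * Real.log 6 := by
        have := Real.log_pow (6 : ℝ) 2
        push_cast at this
        rw [← this]
        exact Real.log_le_log (by norm_num) (by norm_num)
      rw [← Real.le_log_iff_exp_le (by positivity), Real.log_mul (by norm_num) hM0.ne']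
      linarith
    rw [Real.exp_neg, one_div]
    exact inv_anti₀ (Real.exp_pos _) this
  set A := (Finset.Icc 1 T).filter fun t => f t ≤ F
  set B := (Finset.Icc 1 T).filter fun t => ¬ f t ≤ F
  have hAB : A.card + B.card = T := by
    have := Finset.card_filter_add_card_filter_not (s := Finset.Icc 1 T) (fun t => f t ≤ F)
    simpa only [Nat.card_Icc, Nat.add_sub_cancel] using this
  have hB : (B.card : ℝ) ≤ T / 2 := by
    have h1 : B.card * F ≤ ∑ t ∈ Finset.Icc 1 T, f t :=
      calc B.card * F = ∑ t ∈ B, F := by simp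
        _ ≤ ∑ t ∈ B, f t := Finset.sum_le_sum fun t ht => (not_le.1 (Finset.mem_filter.1 ht).2).le
        _ ≤ _ := Finset.sum_le_sum_of_subset_of_nonneg (Finset.filter_subset _ _)
            fun t ht _ => hf0 t ht
    have h2 : B.card * F ≤ T / 2 * F := by
      refine (h1.trans hsum).trans (le_of_eq ?_)
      rw [hF]; ring
    exact le_of_mul_le_mul_right h2 hF0
  have hA : (T : ℝ) / 2 ≤ A.card := by
    have : (A.card : ℝ) + B.card = T := by exact_mod_cast hAB
    linarith
  have hterm : ∀ t ∈ A, 1 / (180 * M) ≤ f t * Real.exp (-(2 * f t)) := by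
    intro t ht
    obtain ⟨ht, htF⟩ := Finset.mem_filter.1 ht
    rcases le_total (f t) (1 / 2) with h | h
    · have h1 : Real.exp (-1) ≤ Real.exp (-(2 * f t)) := Real.exp_le_exp.2 (by linarith)
      have h2 : (66 / 180 : ℝ) ≤ Real.exp (-1) := by
        rw [Real.exp_neg, le_inv_comm₀ (by norm_num) (Real.exp_pos _)]
        have := Real.exp_one_lt_d9
        norm_num
        linarith
      calc 1 / (180 * M) = 1 / (66 * M) * (66 / 180) := by field_simp
        _ ≤ f t * Real.exp (-(2 * f t)) :=
          mul_le_mul (hlow t ht) (h2.trans h1) (by norm_num) (hf0 t ht)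
    · have h1 : Real.exp (-(2 * F)) ≤ Real.exp (-(2 * f t)) := Real.exp_le_exp.2 (by linarith)
      calc 1 / (180 * M) ≤ 1 / 2 * (1 / (6 * M)) := by
            rw [← one_div_mul_one_div, ← one_div_mul_one_div, ← mul_assoc]
            gcongr ?_ * _
            norm_num
        _ ≤ f t * Real.exp (-(2 * f t)) := mul_le_mul h (hexp.trans h1) (by positivity) (hf0 t ht)
  calc T / (360 * M) = T / 2 * (1 / (180 * M)) := by field_simp; ring
    _ ≤ A.card * (1 / (180 * M)) := by gcongr
    _ = ∑ t ∈ A, 1 / (180 * M) := by simp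
    _ ≤ ∑ t ∈ A, f t * Real.exp (-(2 * f t)) := Finset.sum_le_sum hterm
    _ ≤ _ := Finset.sum_le_sum_of_subset_of_nonneg (Finset.filter_subset _ _)
        fun t ht _ => mul_nonneg (hf0 t ht) (Real.exp_pos _).le

/-! ### The random sequences and the load of an instance -/

/-- The probability `c ℓ / (i + 2 c ℓ)`, with `ℓ = ln (v + 1)` and `c = 1350`, with which the node
with ID `v` transmits at age `i`. The constant `c` has to be so large that the failure probability
`exp (-c R / 45)` of an instance of weight `R` outweighs the number `exp (22 R)` of its wake-up
functions. -/
noncomputable def transmitProb (e : ℕ × ℕ) : unitInterval :=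
  ⟨1350 * Real.log (e.1 + 1) / (e.2 + 2 * (1350 * Real.log (e.1 + 1))), by
    have h : 0 ≤ Real.log (e.1 + 1 : ℝ) := Real.log_nonneg (by linarith [e.1.cast_nonneg (α := ℝ)])
    have h2 : (0 : ℝ) ≤ e.2 := e.2.cast_nonneg
    exact ⟨by positivity, div_le_one_of_le₀ (by linarith) (by positivity)⟩⟩

lemma coe_transmitProb (v i : ℕ) : (transmitProb (v, i) : ℝ) =
    1350 * Real.log (v + 1) / (i + 2 * (1350 * Real.log (v + 1))) := rfl

lemma transmitProb_le_half (e : ℕ × ℕ) : (transmitProb e : ℝ) ≤ 1 / 2 := by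
  have h : 0 ≤ Real.log (e.1 + 1 : ℝ) := Real.log_nonneg (by linarith [e.1.cast_nonneg (α := ℝ)])
  have h2 : (0 : ℝ) ≤ e.2 := e.2.cast_nonneg
  exact div_le_of_le_mul₀ (by positivity) (by norm_num) (by linarith)

/-- The delay of the random synchronizer on `(r, k)`-instances. Here `10800 = 8 * 1350`, and
`2 r + 3` bounds the weight of the instance from above (`weight_le`). -/
def randomDelay (r k : ℕ) : ℕ := 10800 * (2 * r + 3) * selfPowRoot k

lemma hasSynchronizerDelay_randomDelay : HasSynchronizerDelay randomDelay := by
  refine ⟨162000, fun r k hr _ => ?_⟩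
  have h1 := selfPowRoot_le_logRatio k
  have h2 : (1 : ℝ) ≤ r := by exact_mod_cast hr
  have h3 : (0 : ℝ) ≤ selfPowRoot k := Nat.cast_nonneg _
  unfold randomDelay
  push_cast
  calc 10800 * (2 * (r : ℝ) + 3) * selfPowRoot k ≤ 10800 * (5 * r) * (3 * logRatio k) := by
        gcongr; linarith
    _ = 162000 * (r * logRatio k) := by ring

/-- The delay allowed for the set `K` of IDs. -/
noncomputable def instanceDelay (K : Finset ℕ) : ℕ :=
  randomDelay ⌊∑ v ∈ K, Real.logb 2 (v : ℝ)⌋₊ K.card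

lemma instanceDelay_mono {K K' : Finset ℕ} (h : K ⊆ K') (hK' : ∀ v ∈ K', 1 ≤ v) :
    instanceDelay K ≤ instanceDelay K' := by
  unfold instanceDelay randomDelay
  have h1 : ⌊∑ v ∈ K, Real.logb 2 (v : ℝ)⌋₊ ≤ ⌊∑ v ∈ K', Real.logb 2 (v : ℝ)⌋₊ :=
    Nat.floor_le_floor (Finset.sum_le_sum_of_subset_of_nonneg h fun v hv _ =>
      Real.logb_nonneg one_lt_two (by exact_mod_cast hK' v hv))
  have h2 := selfPowRoot_mono (Finset.card_le_card h)
  gcongr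

lemma le_instanceDelay {K : Finset ℕ} (hK : ∀ v ∈ K, 1 ≤ v) :
    10800 * weight K * selfPowRoot K.card ≤ instanceDelay K := by
  have := weight_le hK
  unfold instanceDelay randomDelay
  push_cast
  gcongr

lemma instanceDelay_le {K : Finset ℕ} (hne : K.Nonempty) (hK : ∀ v ∈ K, 1 ≤ v) :
    instanceDelay K ≤ 86400 * weight K * selfPowRoot K.card := by
  have := le_eight_mul_weight hne hK
  unfold instanceDelay randomDelay
  push_cast
  have h3 : (0 : ℝ) ≤ selfPowRoot K.card := Nat.cast_nonneg _
  nlinarith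

/-- The nodes of `K` that woke up before time-step `t`. -/
def awakeBefore (K : Finset ℕ) (ω : ℕ → ℕ) (t : ℕ) : Finset ℕ := K.filter fun v => ω v < t

lemma awakeBefore_subset (K : Finset ℕ) (ω : ℕ → ℕ) (t : ℕ) : awakeBefore K ω t ⊆ K :=
  Finset.filter_subset _ _

/-- The instances that matter in the union bound: some node wakes up in time-step `0`, and in no
time-step up to the delay have the nodes awake so far exhausted their own delay. Any instance
violating the second condition is already taken care of by a smaller one. -/
structure IsCritical (K : Finset ℕ) (ω : ℕ → ℕ) : Prop where
  pos : ∀ v ∈ K, 1 ≤ v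
  exists_eq_zero : ∃ v ∈ K, ω v = 0
  le_delay : ∀ t ∈ Finset.Icc 1 (instanceDelay K), t ≤ instanceDelay (awakeBefore K ω t)

lemma IsCritical.nonempty {K : Finset ℕ} {ω : ℕ → ℕ} (h : IsCritical K ω) : K.Nonempty :=
  let ⟨v, hv, _⟩ := h.exists_eq_zero; ⟨v, hv⟩

lemma IsCritical.weight_pos {K : Finset ℕ} {ω : ℕ → ℕ} (h : IsCritical K ω) : 0 < weight K :=
  Finset.sum_pos (fun v hv => log_add_one_pos (h.pos v hv)) h.nonempty

/-- The expected number of transmitters in time-step `t`, when the nodes of `K` wake up according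
to `ω`. -/
noncomputable def load (K : Finset ℕ) (ω : ℕ → ℕ) (t : ℕ) : ℝ :=
  ∑ v ∈ awakeBefore K ω t, (transmitProb (v, t - ω v) : ℝ)

/-- The nodes awake before `t` have age at most `t`, and their weight `R` satisfies
`t ≤ 86400 R M`; hence the load is at least `1350 R / (t + 2700 R) ≥ 1 / (66 M)`. -/
lemma IsCritical.le_load {K : Finset ℕ} {ω : ℕ → ℕ} (h : IsCritical K ω) {t : ℕ}
    (ht : t ∈ Finset.Icc 1 (instanceDelay K)) :
    1 / (66 * (selfPowRoot K.card : ℝ)) ≤ load K ω t := by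
  set M : ℝ := (selfPowRoot K.card : ℝ)
  have hM : 1 ≤ M := Nat.one_le_cast.2 (one_le_selfPowRoot _)
  obtain ⟨u, hu, hu0⟩ := h.exists_eq_zero
  set A := awakeBefore K ω t
  have hsub : A ⊆ K := awakeBefore_subset _ _ _
  have hApos : ∀ v ∈ A, 1 ≤ v := fun v hv => h.pos v (hsub hv)
  have hA : A.Nonempty := ⟨u, Finset.mem_filter.2 ⟨hu, by
    rw [hu0]; exact (Finset.mem_Icc.1 ht).1⟩⟩
  have hW : 0 < weight A := Finset.sum_pos (fun v hv => log_add_one_pos (hApos v hv)) hA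
  have hMA : (selfPowRoot A.card : ℝ) ≤ M :=
    Nat.cast_le.2 (selfPowRoot_mono (Finset.card_le_card hsub))
  have htA : (t : ℝ) ≤ 86400 * weight A * M := by
    calc (t : ℝ) ≤ instanceDelay A := by exact_mod_cast h.le_delay t ht
      _ ≤ 86400 * weight A * selfPowRoot A.card := instanceDelay_le hA hApos
      _ ≤ _ := by gcongr
  have hterm : ∀ v ∈ A, 1350 * Real.log (v + 1) / (t + 2 * (1350 * weight A)) ≤
      (transmitProb (v, t - ω v) : ℝ) := by
    intro v hv
    have hl := log_add_one_pos (hApos v hv)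
    have hlW : Real.log (v + 1) ≤ weight A :=
      Finset.single_le_sum (f := fun v : ℕ => Real.log (v + 1))
        (fun w hw => (log_add_one_pos (hApos w hw)).le) hv
    rw [coe_transmitProb]
    have : ((t - ω v : ℕ) : ℝ) ≤ t := by exact_mod_cast Nat.sub_le _ _
    gcongr
  calc 1 / (66 * M) ≤ 1350 * weight A / (t + 2 * (1350 * weight A)) := by
        rw [div_le_div_iff₀ (by positivity) (by positivity)]
        nlinarith
    _ = ∑ v ∈ A, 1350 * Real.log (v + 1) / (t + 2 * (1350 * weight A)) := by
        rw [weight, Finset.mul_sum, Finset.sum_div]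
    _ ≤ _ := Finset.sum_le_sum hterm

/-- The total load during `T` steps is largest when all nodes wake up at the beginning. -/
lemma sum_load_le (K : Finset ℕ) (ω : ℕ → ℕ) (T : ℕ) :
    ∑ t ∈ Finset.Icc 1 T, load K ω t ≤
      ∑ v ∈ K, ∑ i ∈ Finset.Icc 1 T, (transmitProb (v, i) : ℝ) := by
  simp only [load, awakeBefore, Finset.sum_filter]
  rw [Finset.sum_comm]
  refine Finset.sum_le_sum fun v _ => ?_
  rw [← Finset.sum_filter]
  have hinj : Set.InjOn (fun t => t - ω v)
      ((Finset.Icc 1 T).filter fun t => ω v < t : Finset ℕ) := by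
    intro a ha b hb hab
    simp only [Finset.coe_filter, Finset.mem_Icc, Set.mem_ofPred_eq] at ha hb hab
    omega
  rw [← Finset.sum_image (f := fun i => (transmitProb (v, i) : ℝ)) hinj]
  refine Finset.sum_le_sum_of_subset_of_nonneg ?_ fun i _ _ => (transmitProb (v, i)).2.1
  intro i hi
  simp only [Finset.mem_image, Finset.mem_filter, Finset.mem_Icc] at hi ⊢
  omega

/-- The total load is at most `1350 R ln (33 k ^ 2)`, which is compared with the delay by means of
`ln k ≤ M ln M`. -/
lemma IsCritical.sum_load_le {K : Finset ℕ} {ω : ℕ → ℕ} (h : IsCritical K ω) :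
    ∑ t ∈ Finset.Icc 1 (instanceDelay K), load K ω t ≤
      instanceDelay K / 8 * (2 * Real.log (selfPowRoot K.card) + Real.log 33) := by
  set T := instanceDelay K
  set M : ℝ := (selfPowRoot K.card : ℝ)
  have hM : 1 ≤ M := Nat.one_le_cast.2 (one_le_selfPowRoot _)
  have hk : (1 : ℝ) ≤ K.card := by exact_mod_cast h.nonempty.card_pos
  have hMk : M ≤ K.card := Nat.cast_le.2 (selfPowRoot_le_self h.nonempty.card_pos)
  have hW := h.weight_pos
  have hT : (T : ℝ) ≤ 86400 * weight K * M := instanceDelay_le h.nonempty h.pos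
  have hT' : 10800 * weight K * M ≤ T := le_instanceDelay h.pos
  have hlog : Real.log (1 + K.card * (T / 2700) / weight K) ≤
      2 * Real.log K.card + Real.log 33 := by
    have h1 : Real.log ((33 : ℝ) * (K.card : ℝ) ^ 2) = 2 * Real.log K.card + Real.log 33 := by
      rw [Real.log_mul (by norm_num) (by positivity), Real.log_pow]; push_cast; ring
    rw [← h1]
    refine Real.log_le_log (by positivity) ?_
    have h2 : K.card * (T / 2700) / weight K ≤ 32 * (K.card : ℝ) ^ 2 := by
      rw [div_le_iff₀ hW]
      calc K.card * (T / 2700 : ℝ) ≤ K.card * (86400 * weight K * K.card / 2700) := by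
            gcongr; exact hT.trans (by gcongr)
        _ = _ := by ring
    nlinarith
  calc ∑ t ∈ Finset.Icc 1 T, load K ω t
      ≤ ∑ v ∈ K, ∑ i ∈ Finset.Icc 1 T, (transmitProb (v, i) : ℝ) := _root_.sum_load_le K ω T
    _ ≤ ∑ v ∈ K, 1350 * (Real.log (v + 1) * Real.log (1 + T / 2700 / Real.log (v + 1))) := by
        refine Finset.sum_le_sum fun v hv => ?_
        have hl := log_add_one_pos (h.pos v hv)
        have := sum_div_add_le_log (a := 2 * (1350 * Real.log (v + 1))) (by positivity) T
        calc ∑ i ∈ Finset.Icc 1 T, (transmitProb (v, i) : ℝ)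
            = 1350 * Real.log (v + 1) *
              ∑ i ∈ Finset.Icc 1 T, 1 / (i + 2 * (1350 * Real.log (v + 1))) := by
              rw [Finset.mul_sum]
              exact Finset.sum_congr rfl fun i _ => by rw [coe_transmitProb, mul_one_div]
          _ ≤ 1350 * Real.log (v + 1) * Real.log (1 + T / (2 * (1350 * Real.log (v + 1)))) := by
              gcongr
          _ = _ := by rw [div_div, ← mul_assoc]; norm_num [mul_assoc]
    _ ≤ 1350 * (weight K * Real.log (1 + K.card * (T / 2700) / weight K)) := by
        rw [← Finset.mul_sum]
        gcongr
        exact sum_log_one_add_le h.nonempty h.pos (by positivity)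
    _ ≤ 1350 * (weight K * (2 * (M * Real.log M) + M * Real.log 33)) := by
        gcongr
        refine hlog.trans ?_
        have h1 := log_le_selfPowRoot_mul_log h.nonempty.card_pos
        have h2 : 0 < Real.log 33 := Real.log_pos (by norm_num)
        nlinarith
    _ = 10800 * weight K * M / 8 * (2 * Real.log M + Real.log 33) := by ring
    _ ≤ _ := by
        have := Real.log_nonneg hM
        have h2 : 0 < Real.log 33 := Real.log_pos (by norm_num)
        gcongr

/-! ### The union bound -/

section UnionBound

open MeasureTheory

/-- The random bits used by the nodes of `K` in time-step `j`. -/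
def bitBlock (K : Finset ℕ) (ω : ℕ → ℕ) (j : ℕ) : Finset (ℕ × ℕ) :=
  (awakeBefore K ω j).map ⟨fun v => (v, j - ω v), fun _ _ h => (Prod.ext_iff.1 h).1⟩

lemma card_filter_bitBlock (S : ℕ × ℕ → Bool) (K : Finset ℕ) (ω : ℕ → ℕ) (j : ℕ) :
    ((bitBlock K ω j).filter fun e => S e = true).card =
      (transmitters (fun v i => S (v, i)) K ω j).card := by
  rw [bitBlock, Finset.filter_map, Finset.card_map, awakeBefore, Finset.filter_filter]
  rfl

lemma pairwiseDisjoint_bitBlock (K : Finset ℕ) (ω : ℕ → ℕ) (s : Set ℕ) :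
    s.PairwiseDisjoint (bitBlock K ω) := by
  intro a _ b _ hab
  refine Finset.disjoint_left.2 fun e h1 h2 => hab ?_
  simp only [bitBlock, awakeBefore, Finset.mem_map, Finset.mem_filter] at h1 h2
  obtain ⟨v, hv, rfl⟩ := h1
  obtain ⟨w, hw, hwv⟩ := h2
  obtain ⟨h1, h2⟩ := Prod.ext_iff.1 hwv
  change w = v at h1
  change b - ω w = a - ω v at h2
  subst h1
  omega

/-- The event that no time-step up to the delay has exactly one transmitter. -/
def failureEvent (K : Finset ℕ) (ω : ℕ → ℕ) : Set (ℕ × ℕ → Bool) :=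
  ⋂ j ∈ Finset.Icc 1 (instanceDelay K), notExactlyOne (bitBlock K ω j)

lemma IsCritical.real_failure_le {K : Finset ℕ} {ω : ℕ → ℕ} (h : IsCritical K ω) :
    (randomBits transmitProb).real (failureEvent K ω) ≤ Real.exp (-(30 * weight K)) := by
  refine (randomBits_biInter_notExactlyOne_le _ _ _ (pairwiseDisjoint_bitBlock K ω _)
    transmitProb_le_half).trans ?_
  rw [Real.exp_le_exp, neg_le_neg_iff]
  have hload : ∀ j, ∑ e ∈ bitBlock K ω j, (transmitProb e : ℝ) = load K ω j := fun j => by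
    rw [bitBlock, Finset.sum_map]; rfl
  simp only [hload]
  have hM : (1 : ℝ) ≤ selfPowRoot K.card := by exact_mod_cast one_le_selfPowRoot _
  refine le_trans ?_ (sum_mul_exp_ge hM (fun t ht => h.le_load ht) h.sum_load_le)
  rw [le_div_iff₀ (by positivity)]
  have := le_instanceDelay h.pos
  linarith

/-- The number of wake-up functions to be considered is only exponential in the weight. -/
lemma instanceDelay_add_one_pow_le {K : Finset ℕ} (hne : K.Nonempty) (hK : ∀ v ∈ K, 1 ≤ v) :
    ((instanceDelay K : ℝ) + 1) ^ K.card ≤ Real.exp (22 * weight K) := by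
  have hk : (1 : ℝ) ≤ K.card := by exact_mod_cast hne.card_pos
  have hMk : (selfPowRoot K.card : ℝ) ≤ K.card := by
    exact_mod_cast selfPowRoot_le_self hne.card_pos
  have h1 := card_mul_log_two_le_weight hK
  have h2 := card_mul_log_card_le hK
  have hl2 := Real.log_two_gt_d9
  have hW : 0.69 ≤ weight K := by nlinarith
  have hT : (instanceDelay K : ℝ) + 1 ≤ 2 ^ 17 * (weight K / K.card) * (K.card : ℝ) ^ 2 := by
    have h3 : (instanceDelay K : ℝ) ≤ 86400 * weight K * K.card :=
      (instanceDelay_le hne hK).trans (by gcongr)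
    have h4 : 2 ^ 17 * (weight K / K.card) * (K.card : ℝ) ^ 2 = 2 ^ 17 * (weight K * K.card) := by
      field_simp
    rw [h4]
    nlinarith
  have hlog : Real.log (instanceDelay K + 1) ≤
      17 * Real.log 2 + (weight K / K.card - 1) + 2 * Real.log K.card := by
    refine (Real.log_le_log (by positivity) hT).trans ?_
    rw [Real.log_mul (by positivity) (by positivity), Real.log_mul (by positivity) (by positivity),
      Real.log_pow, Real.log_pow]
    have := Real.log_le_sub_one_of_pos (x := weight K / K.card) (by positivity)
    push_cast
    linarith
  rw [← Real.log_le_iff_le_exp (by positivity), Real.log_pow]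
  calc K.card * Real.log (instanceDelay K + 1)
      ≤ K.card * (17 * Real.log 2 + (weight K / K.card - 1) + 2 * Real.log K.card) := by gcongr
    _ = 17 * (K.card * Real.log 2) + (weight K - K.card) + 2 * (K.card * Real.log K.card) := by
        field_simp
    _ ≤ 22 * weight K := by linarith

open Classical in
/-- The critical wake-up functions of `K` that vanish outside `K` and are bounded by the delay. -/
noncomputable def criticalWakeups (K : Finset ℕ) : Finset (ℕ →₀ ℕ) :=
  (K.finsupp fun _ => Finset.range (instanceDelay K + 1)).filter fun ω => IsCritical K ω

lemma real_biUnion_failure_le (K : Finset ℕ) :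
    (randomBits transmitProb).real (⋃ ω ∈ criticalWakeups K, failureEvent K ω) ≤
      ∏ v ∈ K, (1 : ℝ) / (v + 1) ^ 3 := by
  classical
  by_cases h : ∃ ω, ω ∈ criticalWakeups K
  swap
  · push Not at h
    simp only [h, Set.iUnion_of_empty, Set.iUnion_empty, measureReal_empty]
    exact Finset.prod_nonneg fun _ _ => by positivity
  obtain ⟨ω₀, h₀⟩ := h
  have hcrit := (Finset.mem_filter.1 h₀).2
  have hcard : ((criticalWakeups K).card : ℝ) ≤ ((instanceDelay K : ℝ) + 1) ^ K.card := by
    have h1 : (criticalWakeups K).card ≤ (instanceDelay K + 1) ^ K.card := by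
      refine (Finset.card_filter_le _ _).trans ?_
      rw [Finset.card_finsupp]
      simp
    exact_mod_cast h1
  calc (randomBits transmitProb).real (⋃ ω ∈ criticalWakeups K, failureEvent K ω)
      ≤ ∑ ω ∈ criticalWakeups K, (randomBits transmitProb).real (failureEvent K ω) :=
        measureReal_biUnion_finset_le _ _
    _ ≤ ∑ ω ∈ criticalWakeups K, Real.exp (-(30 * weight K)) :=
        Finset.sum_le_sum fun ω hω => (Finset.mem_filter.1 hω).2.real_failure_le
    _ = (criticalWakeups K).card * Real.exp (-(30 * weight K)) := by simp
    _ ≤ Real.exp (22 * weight K) * Real.exp (-(30 * weight K)) := by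
        gcongr
        exact hcard.trans (instanceDelay_add_one_pow_le hcrit.nonempty hcrit.pos)
    _ ≤ Real.exp (-(3 * weight K)) := by
        rw [← Real.exp_add, Real.exp_le_exp]
        linarith [hcrit.weight_pos]
    _ = ∏ v ∈ K, (1 : ℝ) / (v + 1) ^ 3 := by
        rw [weight, Finset.mul_sum, ← Finset.sum_neg_distrib, Real.exp_sum]
        refine Finset.prod_congr rfl fun v _ => ?_
        rw [Real.exp_neg, one_div]
        congr 1
        rw [← Real.exp_log (by positivity : (0 : ℝ) < (v + 1) ^ 3), Real.log_pow]
        norm_num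

lemma criticalWakeups_eq_empty {K : Finset ℕ} (h : ¬(K.Nonempty ∧ ∀ v ∈ K, 1 ≤ v)) :
    criticalWakeups K = ∅ := by
  classical
  refine Finset.filter_eq_empty_iff.2 fun ω _ hω => h ⟨hω.nonempty, hω.pos⟩

/-- The failure probabilities of all critical instances add up to less than one, because the sum
over `K` of `∏ v ∈ K, (v + 1) ^ (-3)` factors as a product. -/
lemma sum_real_biUnion_failure_le (s : Finset (Finset ℕ)) :
    ∑ K ∈ s, (randomBits transmitProb).real (⋃ ω ∈ criticalWakeups K, failureEvent K ω) ≤ 0.7 := by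
  classical
  set s' := s.filter fun K => K.Nonempty ∧ ∀ v ∈ K, 1 ≤ v
  set x : ℕ → ℝ := fun v => 1 / (v + 1) ^ 3
  set U := Finset.Icc 1 ((s.biUnion id).sup id)
  have hsub : s' ⊆ U.powerset.erase ∅ := by
    intro K hK
    obtain ⟨hKs, hne, hpos⟩ := Finset.mem_filter.1 hK
    refine Finset.mem_erase.2 ⟨hne.ne_empty, Finset.mem_powerset.2 fun v hv => ?_⟩
    exact Finset.mem_Icc.2 ⟨hpos v hv,
      Finset.le_sup (f := id) (Finset.mem_biUnion.2 ⟨K, hKs, hv⟩)⟩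
  have hx : ∑ v ∈ U, x v ≤ 1 / 2 := by
    have h1 : ∑ v ∈ U, (1 : ℝ) / (v + 1) ^ 2 ≤ 1 :=
      sum_inv_add_one_sq_le_one fun v hv => (Finset.mem_Icc.1 hv).1
    have h2 : ∀ v ∈ U, x v ≤ 1 / 2 * ((1 : ℝ) / (v + 1) ^ 2) := by
      intro v hv
      have : (1 : ℝ) ≤ v := by exact_mod_cast (Finset.mem_Icc.1 hv).1
      rw [one_div_mul_one_div]
      refine one_div_le_one_div_of_le (by positivity) ?_
      nlinarith [mul_nonneg (sq_nonneg ((v : ℝ) + 1)) (sub_nonneg.2 this)]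
    have h3 := Finset.sum_le_sum h2
    rw [← Finset.mul_sum] at h3
    linarith
  calc ∑ K ∈ s, (randomBits transmitProb).real (⋃ ω ∈ criticalWakeups K, failureEvent K ω)
      = ∑ K ∈ s', (randomBits transmitProb).real (⋃ ω ∈ criticalWakeups K, failureEvent K ω) := by
        refine (Finset.sum_filter_of_ne fun K _ hK => ?_).symm
        by_contra h
        exact hK (by simp [criticalWakeups_eq_empty h])
    _ ≤ ∑ K ∈ s', ∏ v ∈ K, x v := Finset.sum_le_sum fun K _ => real_biUnion_failure_le K
    _ ≤ ∑ K ∈ U.powerset.erase ∅, ∏ v ∈ K, x v :=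
        Finset.sum_le_sum_of_subset_of_nonneg hsub fun K _ _ =>
          Finset.prod_nonneg fun _ _ => by positivity
    _ = ∏ v ∈ U, (1 + x v) - 1 := by
        rw [Finset.prod_one_add, ← Finset.add_sum_erase _ _ (Finset.empty_mem_powerset U)]
        simp
    _ ≤ Real.exp (∑ v ∈ U, x v) - 1 := by
        rw [Real.exp_sum]
        refine sub_le_sub_right (Finset.prod_le_prod (fun v _ => by positivity) fun v _ => ?_) 1
        linarith [Real.add_one_le_exp (x v)]
    _ ≤ Real.exp (1 / 2) - 1 := by gcongr
    _ ≤ 0.7 := by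
        have h1 : Real.exp (1 / 2) ^ 2 = Real.exp 1 := by
          rw [← Real.exp_nat_mul]; norm_num
        have h2 := Real.exp_one_lt_d9
        have h3 := Real.exp_pos (1 / 2)
        nlinarith

/-- Some choice of all the bits succeeds on every critical instance. -/
lemma exists_forall_notMem_failure :
    ∃ S : ℕ × ℕ → Bool, ∀ (K : Finset ℕ), ∀ ω ∈ criticalWakeups K, S ∉ failureEvent K ω := by
  by_contra! h
  have huniv : (⋃ K : Finset ℕ, ⋃ ω ∈ criticalWakeups K, failureEvent K ω) = Set.univ := by
    refine Set.eq_univ_of_forall fun S => ?_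
    obtain ⟨K, ω, hω, hS⟩ := h S
    simp only [Set.mem_iUnion]
    exact ⟨K, ω, hω, hS⟩
  have h1 : randomBits transmitProb Set.univ ≤ ENNReal.ofReal 0.7 := by
    rw [← huniv]
    refine (measure_iUnion_le _).trans ?_
    rw [ENNReal.tsum_eq_iSup_sum]
    refine iSup_le fun s => ?_
    rw [ENNReal.le_ofReal_iff_toReal_le (by simp) (by norm_num),
      ENNReal.toReal_sum (by simp)]
    exact sum_real_biUnion_failure_le s
  rw [measure_univ, ENNReal.one_le_ofReal] at h1
  norm_num at h1

end UnionBound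

/-! ### Existence of synchronizers -/

/-- The sequences chosen by the union bound succeed on every instance starting in time-step `0`:
a smallest instance on which they fail would be critical. -/
lemma exists_card_transmitters_eq_one {S : ℕ × ℕ → Bool}
    (hS : ∀ (K : Finset ℕ), ∀ ω ∈ criticalWakeups K, S ∉ failureEvent K ω)
    (K : Finset ℕ) (hpos : ∀ v ∈ K, 1 ≤ v) (ω : ℕ → ℕ) (h0 : ∃ v ∈ K, ω v = 0) :
    ∃ j ∈ Finset.Icc 1 (instanceDelay K),
      (transmitters (fun v i => S (v, i)) K ω j).card = 1 := by
  classical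
  induction K using Finset.strongInduction with
  | H K ih =>
  by_contra! hno
  -- a proper subset of the nodes, those awake before `t`, succeeds only after time-step `t`
  have hsmall : ∀ t, 1 ≤ t → awakeBefore K ω t ≠ K → t ≤ instanceDelay K + 1 →
      t ≤ instanceDelay (awakeBefore K ω t) := by
    intro t ht hne htT
    have hsub := awakeBefore_subset K ω t
    obtain ⟨u, hu, hu0⟩ := h0
    obtain ⟨j, hj, hj1⟩ := ih _ (hsub.ssubset_of_ne hne) (fun v hv => hpos v (hsub hv))
      ⟨u, Finset.mem_filter.2 ⟨hu, by omega⟩, hu0⟩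
    by_contra! hlt
    have hj' := Finset.mem_Icc.1 hj
    have hjT := instanceDelay_mono hsub hpos
    refine hno j (Finset.mem_Icc.2 ⟨hj'.1, by omega⟩) ?_
    rw [← hj1]
    congr 1
    ext v
    simp only [transmitters, awakeBefore, Finset.mem_filter]
    constructor
    · rintro ⟨h1, h2, h3⟩
      exact ⟨⟨h1, by omega⟩, h2, h3⟩
    · rintro ⟨⟨h1, -⟩, h2, h3⟩
      exact ⟨h1, h2, h3⟩
  have hall : awakeBefore K ω (instanceDelay K + 1) = K := by
    by_contra hne
    have h1 := hsmall _ (by omega) hne le_rfl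
    have h2 := instanceDelay_mono (awakeBefore_subset K ω (instanceDelay K + 1)) hpos
    omega
  set ω' : ℕ →₀ ℕ := Finsupp.indicator K fun v _ => ω v
  have hω' : ∀ v ∈ K, ω' v = ω v := fun v hv => Finsupp.indicator_of_mem hv _
  have hawake : ∀ t, awakeBefore K ω' t = awakeBefore K ω t := fun t =>
    Finset.filter_congr fun v hv => by rw [hω' v hv]
  have htrans : ∀ j, transmitters (fun v i => S (v, i)) K ω' j =
      transmitters (fun v i => S (v, i)) K ω j := fun j =>
    Finset.filter_congr fun v hv => by rw [hω' v hv]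
  have hcrit : IsCritical K ω' := by
    refine ⟨hpos, ?_, fun t ht => ?_⟩
    · obtain ⟨u, hu, hu0⟩ := h0
      exact ⟨u, hu, by rw [hω' u hu, hu0]⟩
    · obtain ⟨h1, h2⟩ := Finset.mem_Icc.1 ht
      rw [hawake]
      by_cases h : awakeBefore K ω t = K
      · rwa [h]
      · exact hsmall t h1 h (by omega)
  refine hS K ω' (Finset.mem_filter.2 ⟨Finset.mem_finsupp_iff.2
    ⟨Finsupp.support_indicator_subset _ _, fun v hv => ?_⟩, hcrit⟩) ?_
  · rw [hω' v hv, Finset.mem_range]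
    rw [← hall] at hv
    exact (Finset.mem_filter.1 hv).2
  · simp only [failureEvent, Set.mem_iInter]
    intro j hj
    change _ ≠ 1
    rw [card_filter_bitBlock, htrans]
    exact hno j hj

theorem exists_isUnboundedUniversalSynchronizer :
    ∃ S : ℕ → ℕ → Bool, IsUnboundedUniversalSynchronizer S randomDelay := by
  obtain ⟨S, hS⟩ := exists_forall_notMem_failure
  refine ⟨fun v i => S (v, i), ?_⟩
  rintro r k K ⟨-, hpos, rfl, rfl⟩ hK ω
  obtain ⟨u, hu, hum⟩ := Finset.exists_mem_eq_inf' hK ω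
  set m := K.inf' hK ω
  have hm : ∀ v ∈ K, m ≤ ω v := fun v hv => Finset.inf'_le _ hv
  obtain ⟨j, hj, hj1⟩ := exists_card_transmitters_eq_one hS K hpos (fun v => ω v - m)
    ⟨u, hu, by simp [← hum]⟩
  refine ⟨m + j, by have := (Finset.mem_Icc.1 hj).2; unfold instanceDelay at this; omega, ?_⟩
  rw [← hj1]
  congr 1
  refine Finset.filter_congr fun v hv => ?_
  have := hm v hv
  have h1 : m + j - ω v = j - (ω v - m) := by omega
  rw [h1]
  refine and_congr_left fun _ => ?_
  change _ ↔ ω v - m < j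
  omega

/-! ### Wake-up in radio networks -/

section Network

variable {V : Type*} {G : Digraph V} {S : ℕ → ℕ → Bool} {ident : V → ℕ} {σ : V → Option ℕ}

lemma wakeState_succ_of_eq_some {t s : ℕ} {v : V} (h : wakeState G S ident σ t v = some s) :
    wakeState G S ident σ (t + 1) v = some s := by
  simp only [wakeState, h]

lemma wakeState_eq_some_iff {t s : ℕ} {v : V} :
    wakeState G S ident σ t v = some s ↔ s < t ∧ WakesAt G S ident σ v s := by
  constructor
  · intro h
    induction t with
    | zero => simp [wakeState] at h
    | succ t ih =>
      rcases hv : wakeState G S ident σ t v with _ | s'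
      · have h' := h
        simp only [wakeState, hv] at h'
        split_ifs at h'
        obtain rfl : t = s := by simpa using h'
        exact ⟨by omega, h⟩
      · rw [wakeState_succ_of_eq_some hv] at h
        obtain rfl : s' = s := by simpa using h
        have := ih hv
        exact ⟨by omega, this.2⟩
  · rintro ⟨hst, h⟩
    induction t, hst using Nat.le_induction with
    | base => exact h
    | succ t _ ih => exact wakeState_succ_of_eq_some ih

lemma exists_wakesAt_of_or {t : ℕ} {v : V}
    (h : σ v = some t ∨ Receives G S ident (wakeState G S ident σ t) v t) :
    ∃ s ≤ t, WakesAt G S ident σ v s := by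
  rcases hv : wakeState G S ident σ t v with _ | s
  · refine ⟨t, le_rfl, ?_⟩
    simp only [WakesAt, wakeState, hv, if_pos h]
  · have := wakeState_eq_some_iff.1 hv
    exact ⟨s, this.1.le, this.2⟩

lemma WakesAt.unique {s t : ℕ} {v : V} (hs : WakesAt G S ident σ v s)
    (ht : WakesAt G S ident σ v t) : s = t := by
  have h1 := wakeState_eq_some_iff.2 ⟨(by omega : s < s + t + 1), hs⟩
  have h2 := wakeState_eq_some_iff.2 ⟨(by omega : t < s + t + 1), ht⟩
  rw [h1] at h2
  simpa using h2

/-- The delay that `g` allows for the set `K` of nodes. -/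
noncomputable def nodeDelay (g : ℕ → ℕ → ℕ) (ident : V → ℕ) (K : Finset V) : ℕ :=
  g ⌊∑ u ∈ K, Real.logb 2 (ident u : ℝ)⌋₊ K.card

/-- Let the in-neighbours of `x` be `K` and possibly nodes of `A`, where `x ∈ A`. Once a node of
`K` is awake, a node of `A` wakes up within the delay allowed for `K`: as long as all of `A` is
dormant, the only nodes that `x` can hear are those of `K`. -/
lemma exists_wakesAt_of_inNeighbours {g : ℕ → ℕ → ℕ} (hS : IsUnboundedUniversalSynchronizer S g)
    (hinj : Function.Injective ident) (hpos : ∀ v, 1 ≤ ident v) {x : V} {K A : Finset V}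
    (hK : ∀ u ∈ K, G.Adj u x) (hKA : ∀ u, G.Adj u x → u ∈ K ∨ u ∈ A) (hx : x ∈ A)
    {y : V} (hy : y ∈ K) {s : ℕ} (hys : WakesAt G S ident σ y s) :
    ∃ z ∈ A, ∃ t ≤ s + nodeDelay g ident K, WakesAt G S ident σ z t := by
  classical
  by_contra! hno
  set D := s + nodeDelay g ident K with hD
  have : Nonempty V := ⟨x⟩
  -- nodes that never wake up are given a wake-up time after the end of the period considered
  set τ : V → ℕ := fun u => if h : ∃ t, WakesAt G S ident σ u t then h.choose else D + 1
  have hτ : ∀ u t, WakesAt G S ident σ u t → τ u = t := fun u t h => by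
    have hex : ∃ t, WakesAt G S ident σ u t := ⟨t, h⟩
    simp only [τ, dif_pos hex]
    exact hex.choose_spec.unique h
  have hτ' : ∀ u j, j ≤ D → τ u < j → WakesAt G S ident σ u (τ u) := fun u j hj h => by
    by_cases hex : ∃ t, WakesAt G S ident σ u t
    · simp only [τ, dif_pos hex]
      exact hex.choose_spec
    · simp only [τ, dif_neg hex] at h
      omega
  set ω : ℕ → ℕ := fun i => τ (Function.invFun ident i)
  have hω : ∀ u, ω (ident u) = τ u := fun u => by
    simp only [ω, Function.leftInverse_invFun hinj u]
  set e : V ↪ ℕ := ⟨ident, hinj⟩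
  have hinst : IsInstance ⌊∑ u ∈ K, Real.logb 2 (ident u : ℝ)⌋₊ K.card (K.map e) := by
    refine ⟨⟨ident y, Finset.mem_map_of_mem e hy⟩, ?_, Finset.card_map _, ?_⟩
    · intro v hv
      obtain ⟨u, -, rfl⟩ := Finset.mem_map.1 hv
      exact hpos u
    · rw [Finset.sum_map]; rfl
  obtain ⟨j, hj, hj1⟩ := hS _ _ _ hinst hinst.1 ω
  have hjD : j ≤ D := by
    have h1 : (K.map e).inf' hinst.1 ω ≤ ω (ident y) :=
      Finset.inf'_le _ (Finset.mem_map_of_mem e hy)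
    rw [hω, hτ y s hys] at h1
    rw [hD, nodeDelay]
    omega
  obtain ⟨i, hi⟩ := Finset.card_eq_one.1 hj1
  have htr : ∀ u, u ∈ K → (Transmits S ident (wakeState G S ident σ j) u j ↔ ident u = i) := by
    intro u hu
    rw [← Finset.mem_singleton, ← hi]
    simp only [transmitters, Finset.mem_filter, Transmits, wakeState_eq_some_iff, hω]
    constructor
    · rintro ⟨t, ⟨-, ht⟩, htj, htS⟩
      rw [hτ u t ht]
      exact ⟨Finset.mem_map_of_mem e hu, htj, htS⟩
    · rintro ⟨-, h1, h2⟩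
      exact ⟨τ u, ⟨h1, hτ' u j hjD h1⟩, h1, h2⟩
  obtain ⟨u, hu, hui⟩ : ∃ u ∈ K, ident u = i := by
    have : i ∈ transmitters S (K.map e) ω j := by rw [hi]; simp
    obtain ⟨u, hu, rfl⟩ := Finset.mem_map.1 (Finset.mem_filter.1 this).1
    exact ⟨u, hu, rfl⟩
  have hrec : Receives G S ident (wakeState G S ident σ j) x j := by
    refine ⟨u, ⟨hK u hu, (htr u hu).2 hui⟩, ?_⟩
    rintro w ⟨hw, hwt⟩
    rcases hKA w hw with hwK | hwA
    · exact hinj (((htr w hwK).1 hwt).trans hui.symm)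
    · obtain ⟨t, ht, htj, -⟩ := hwt
      exact absurd (wakeState_eq_some_iff.1 ht).2 (hno w hwA t (by omega))
  obtain ⟨t, ht, htx⟩ := exists_wakesAt_of_or (Or.inr hrec)
  exact hno x hx t (ht.trans hjD) htx

/-- The layers along a walk from `u` to `v`: disjoint sets of nodes such that the wake-up signal
travels from `u` to `v` within the sum of their delays. The layer of a node `x` of the walk
consists of those in-neighbours of `x` that belong neither to a later layer nor to `{v}`. -/
lemma exists_layers {g : ℕ → ℕ → ℕ} [Fintype V] (hS : IsUnboundedUniversalSynchronizer S g)
    (hinj : Function.Injective ident) (hpos : ∀ v, 1 ≤ ident v) {u v : V}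
    (huv : Relation.ReflTransGen G.Adj u v) :
    ∃ (A : Finset V) (𝓚 : Finset (Finset V)), u ∈ A ∧
      (∀ K ∈ 𝓚, K.Nonempty ∧ K ⊆ A) ∧ (𝓚 : Set (Finset V)).PairwiseDisjoint id ∧
      ∀ y ∈ A, ∀ s, WakesAt G S ident σ y s →
        ∃ t ≤ s + ∑ K ∈ 𝓚, nodeDelay g ident K, WakesAt G S ident σ v t := by
  classical
  induction huv using Relation.ReflTransGen.head_induction_on with
  | refl =>
    refine ⟨{v}, ∅, by simp, by simp, by simp, fun y hy s hs => ⟨s, by simp, ?_⟩⟩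
    rwa [Finset.mem_singleton.1 hy] at hs
  | @head u x hux _ ih =>
    obtain ⟨A, 𝓚, hxA, h𝓚, hdisj, hwake⟩ := ih
    set K := Finset.univ.filter fun w => G.Adj w x ∧ w ∉ A
    have hmem : ∀ w, G.Adj w x → w ∈ K ∨ w ∈ A := fun w hw => by
      by_cases h : w ∈ A
      · exact Or.inr h
      · exact Or.inl (by simp [K, hw, h])
    rcases K.eq_empty_or_nonempty with hK | hK
    · exact ⟨A, 𝓚, by simpa [hK] using hmem u hux, h𝓚, hdisj, hwake⟩
    have hKA : Disjoint K A := Finset.disjoint_left.2 fun w hw => (Finset.mem_filter.1 hw).2.2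
    have hnot : K ∉ 𝓚 := fun h => by
      obtain ⟨w, hw⟩ := hK
      exact Finset.disjoint_left.1 hKA hw ((h𝓚 K h).2 hw)
    refine ⟨K ∪ A, insert K 𝓚, Finset.mem_union.2 (hmem u hux), ?_, ?_, ?_⟩
    · intro B hB
      rcases Finset.mem_insert.1 hB with rfl | hB
      · exact ⟨hK, Finset.subset_union_left⟩
      · exact ⟨(h𝓚 B hB).1, (h𝓚 B hB).2.trans Finset.subset_union_right⟩
    · rw [Finset.coe_insert]
      exact hdisj.insert fun B hB _ => hKA.mono_right (h𝓚 B hB).2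
    · intro y hy s hs
      rw [Finset.sum_insert hnot]
      rcases Finset.mem_union.1 hy with hy | hy
      · obtain ⟨z, hz, t, ht, hzt⟩ := exists_wakesAt_of_inNeighbours hS hinj hpos
          (fun w hw => (Finset.mem_filter.1 hw).2.1) hmem hxA hy hs
        obtain ⟨t', ht', h⟩ := hwake z hz t hzt
        exact ⟨t', by omega, h⟩
      · obtain ⟨t', ht', h⟩ := hwake y hy s hs
        exact ⟨t', by omega, h⟩

/-- An instance with `r = 0` consists of the ID `1` only, whence the additive constant
`g 0 1`. -/
lemma nodeDelay_le {g : ℕ → ℕ → ℕ} {C : ℝ} (hC : 0 ≤ C)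
    (hg : ∀ r k : ℕ, 1 ≤ r → 1 ≤ k → (g r k : ℝ) ≤ C * (r * logRatio k)) [Fintype V]
    (hinj : Function.Injective ident) (hpos : ∀ v, 1 ≤ ident v) {K : Finset V}
    (hK : K.Nonempty) :
    (nodeDelay g ident K : ℝ) ≤ 2 * C * logRatio (Fintype.card V) *
      ∑ u ∈ K, Real.logb 2 (ident u : ℝ) + g 0 1 := by
  have hlog : ∀ u, 0 ≤ Real.logb 2 (ident u : ℝ) := fun u =>
    Real.logb_nonneg one_lt_two (by exact_mod_cast hpos u)
  have hsum : 0 ≤ ∑ u ∈ K, Real.logb 2 (ident u : ℝ) := Finset.sum_nonneg fun u _ => hlog u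
  have hn := one_le_logRatio (Fintype.card V)
  unfold nodeDelay
  set r := ⌊∑ u ∈ K, Real.logb 2 (ident u : ℝ)⌋₊ with hr
  rcases Nat.eq_zero_or_pos r with h0 | h1
  · have hone : ∀ u ∈ K, ident u = 1 := by
      intro u hu
      by_contra hne
      have h2 : 2 ≤ ident u := by have := hpos u; omega
      have h3 : (1 : ℝ) ≤ Real.logb 2 (ident u : ℝ) := by
        rw [Real.le_logb_iff_rpow_le one_lt_two (by exact_mod_cast hpos u)]
        simpa using h2
      have h4 := Finset.single_le_sum (f := fun u => Real.logb 2 (ident u : ℝ))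
        (fun u _ => hlog u) hu
      have h5 := Nat.floor_eq_zero.1 (hr.symm.trans h0)
      linarith
    have hcard : K.card = 1 := by
      refine le_antisymm (Finset.card_le_one.2 fun a ha b hb => hinj ?_) hK.card_pos
      rw [hone a ha, hone b hb]
    rw [h0, hcard]
    have : 0 ≤ 2 * C * logRatio (Fintype.card V) * ∑ u ∈ K, Real.logb 2 (ident u : ℝ) := by
      positivity
    linarith
  · have h2 := logRatio_le_two_mul hK.card_pos (Finset.card_le_univ K)
    have h3 : (r : ℝ) ≤ ∑ u ∈ K, Real.logb 2 (ident u : ℝ) := Nat.floor_le hsum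
    have h4 : (0 : ℝ) ≤ g 0 1 := Nat.cast_nonneg _
    calc (g r K.card : ℝ) ≤ C * (r * logRatio K.card) := hg _ _ h1 hK.card_pos
      _ ≤ C * ((∑ u ∈ K, Real.logb 2 (ident u : ℝ)) * (2 * logRatio (Fintype.card V))) := by
          have := one_le_logRatio K.card
          gcongr
      _ = 2 * C * logRatio (Fintype.card V) * ∑ u ∈ K, Real.logb 2 (ident u : ℝ) := by ring
      _ ≤ _ := by linarith

lemma sum_nodeDelay_le {g : ℕ → ℕ → ℕ} {C : ℝ} (hC : 0 ≤ C)
    (hg : ∀ r k : ℕ, 1 ≤ r → 1 ≤ k → (g r k : ℝ) ≤ C * (r * logRatio k)) [Fintype V]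
    (hinj : Function.Injective ident) {L : ℕ} (hL : ∀ v, 1 ≤ ident v ∧ ident v ≤ L) (hL2 : 2 ≤ L)
    {𝓚 : Finset (Finset V)} (hne : ∀ K ∈ 𝓚, K.Nonempty)
    (hdisj : (𝓚 : Set (Finset V)).PairwiseDisjoint id) :
    ∑ K ∈ 𝓚, (nodeDelay g ident K : ℝ) ≤ (2 * C + g 0 1) *
      (Fintype.card V * Real.logb 2 L * logRatio (Fintype.card V)) := by
  classical
  set n := Fintype.card V
  have hn := one_le_logRatio n
  have hpos : ∀ v, 1 ≤ ident v := fun v => (hL v).1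
  have hlogL : 1 ≤ Real.logb 2 (L : ℝ) := by
    rw [Real.le_logb_iff_rpow_le one_lt_two (by exact_mod_cast (by omega : 0 < L))]
    simpa using hL2
  have hcard : (𝓚.card : ℝ) ≤ n := by
    have h1 : 𝓚.card ≤ ∑ K ∈ 𝓚, K.card := by
      rw [Finset.card_eq_sum_ones]
      exact Finset.sum_le_sum fun K hK => (hne K hK).card_pos
    have h2 := Finset.card_biUnion hdisj
    have h3 := Finset.card_le_univ (𝓚.biUnion id)
    simp only [id] at h2
    exact_mod_cast h1.trans (h2.symm.trans_le h3)
  have hsum : ∑ K ∈ 𝓚, ∑ u ∈ K, Real.logb 2 (ident u : ℝ) ≤ n * Real.logb 2 L := by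
    have h1 := Finset.sum_biUnion (f := fun u => Real.logb 2 (ident u : ℝ)) hdisj
    simp only [id] at h1
    rw [← h1]
    calc _ ≤ ∑ u, Real.logb 2 (ident u : ℝ) :=
          Finset.sum_le_sum_of_subset_of_nonneg (Finset.subset_univ _) fun u _ _ =>
            Real.logb_nonneg one_lt_two (by exact_mod_cast hpos u)
      _ ≤ ∑ _u : V, Real.logb 2 (L : ℝ) := Finset.sum_le_sum fun u _ =>
          Real.logb_le_logb_of_le one_lt_two (by exact_mod_cast hpos u)
            (by exact_mod_cast (hL u).2)
      _ = n * Real.logb 2 L := by simp [n]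
  calc ∑ K ∈ 𝓚, (nodeDelay g ident K : ℝ)
      ≤ ∑ K ∈ 𝓚, (2 * C * logRatio n * ∑ u ∈ K, Real.logb 2 (ident u : ℝ) + g 0 1) :=
        Finset.sum_le_sum fun K hK => nodeDelay_le hC hg hinj hpos (hne K hK)
    _ = 2 * C * logRatio n * ∑ K ∈ 𝓚, ∑ u ∈ K, Real.logb 2 (ident u : ℝ) +
          g 0 1 * 𝓚.card := by
        rw [Finset.sum_add_distrib, ← Finset.mul_sum, Finset.sum_const, nsmul_eq_mul, mul_comm
          (𝓚.card : ℝ)]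
    _ ≤ 2 * C * logRatio n * (n * Real.logb 2 L) + g 0 1 * (n * (Real.logb 2 L * logRatio n)) := by
        gcongr
        exact hcard.trans (le_mul_of_one_le_right (Nat.cast_nonneg _) (by nlinarith))
    _ = _ := by ring

end Network

theorem mainTheorem5 :
    (∃ (S : ℕ → ℕ → Bool) (g : ℕ → ℕ → ℕ),
      IsUnboundedUniversalSynchronizer S g ∧ HasSynchronizerDelay g) ∧
    ∀ (S : ℕ → ℕ → Bool) (g : ℕ → ℕ → ℕ),
      IsUnboundedUniversalSynchronizer S g → HasSynchronizerDelay g →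
      ∃ C : ℝ, ∀ (V : Type*) [Fintype V] (G : Digraph V) (ident : V → ℕ) (L : ℕ)
        (σ : V → Option ℕ),
        IsStronglyConnected G → Function.Injective ident →
        (∀ v, 1 ≤ ident v ∧ ident v ≤ L) → (∃ v t, σ v = some t) →
        ∃ t₀ : ℕ, IsLeast {t | ∃ v, WakesAt G S ident σ v t} t₀ ∧
          ∀ v, ∃ t : ℕ, WakesAt G S ident σ v t ∧
            (t : ℝ) ≤ t₀ +
              C * (Fintype.card V * Real.logb 2 L * logRatio (Fintype.card V)) := by
  constructor
  · obtain ⟨S, hS⟩ := exists_isUnboundedUniversalSynchronizer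
    exact ⟨S, randomDelay, hS, hasSynchronizerDelay_randomDelay⟩
  rintro S g hS ⟨C, hC⟩
  have hC' : ∀ r k : ℕ, 1 ≤ r → 1 ≤ k → (g r k : ℝ) ≤ max C 0 * (r * logRatio k) :=
    fun r k hr hk => (hC r k hr hk).trans (by
      have := one_le_logRatio k
      gcongr
      exact le_max_left _ _)
  refine ⟨2 * max C 0 + g 0 1, ?_⟩
  intro V _ G ident L σ hG hinj hL ⟨v₁, t₁, h₁⟩
  have hne : {t | ∃ v, WakesAt G S ident σ v t}.Nonempty := by
    obtain ⟨s, -, hs⟩ := exists_wakesAt_of_or (G := G) (S := S) (ident := ident) (Or.inl h₁)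
    exact ⟨s, v₁, hs⟩
  have hleast := isLeast_csInf hne
  refine ⟨_, hleast, fun v => ?_⟩
  obtain ⟨u, hu⟩ := hleast.1
  set t₀ := sInf {t | ∃ v, WakesAt G S ident σ v t}
  by_cases huv : u = v
  · subst huv
    refine ⟨t₀, hu, le_add_of_nonneg_right ?_⟩
    have hlogL : 0 ≤ Real.logb 2 (L : ℝ) :=
      Real.logb_nonneg one_lt_two (by exact_mod_cast (hL u).1.trans (hL u).2)
    have := one_le_logRatio (Fintype.card V)
    positivity
  have hL2 : 2 ≤ L := by
    have h1 := hL u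
    have h2 := hL v
    have h3 : ident u ≠ ident v := fun h => huv (hinj h)
    omega
  obtain ⟨A, 𝓚, huA, h𝓚, hdisj, hwake⟩ :=
    exists_layers (σ := σ) hS hinj (fun v => (hL v).1) (hG u v)
  obtain ⟨t, ht, hvt⟩ := hwake u huA t₀ hu
  refine ⟨t, hvt, ?_⟩
  have h := sum_nodeDelay_le (le_max_right C 0) hC' hinj hL hL2 (fun K hK => (h𝓚 K hK).1) hdisj
  have h' : (t : ℝ) ≤ t₀ + ∑ K ∈ 𝓚, (nodeDelay g ident K : ℝ) := by exact_mod_cast ht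
  linarith
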